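/- Let $d\ge 3$ and $\nu>1$. For $\alpha>0$ and $x\in\mathbb{R}^d$ let $W^\alpha_x$ be the law on $C([0,\infty);\mathbb{R}^d)$ of Brownian motion with variance $\alpha$ started at $x$ (that is, of $x+\sqrt{\alpha}\,B$ with $B$ a standard $d$-dimensional Brownian motion). For a set $V\subset\mathbb{R}^d$ let $\tau_V=\inf\{t\ge 0 : X_t\notin V\}$ be the exit time of the canonical path $X$ from $V$. Below, $\alpha$ denotes an arbitrary number in $[\frac{1}{2\nu},2\nu]$; in particular the estimates hold with $\alpha=\alpha_n$, uniformly in $n\ge 0$, for every sequence $(\alpha_n)_{n\ge0}$ with $\frac1{2\nu}\le\alpha_n\le 2\nu$. 1. (Annuli.) For $0<r_1<r_2<\infty$ let $A_{r_1,r_2}=B_{r_2}\setminus\overline{B}_{r_1}$, with the balls centred at the origin. For all $0<r_1<r_2<\infty$ there is $C>0$, depending only on $d,\nu,r_1,r_2$, such that for every $\alpha\in[\frac1{2\nu},2\nu]$ $$E^{W^\alpha_x}(\tau_{A_{r_1,r_2}})\le C\,d(x,\partial B_{r_1})\quad\text{for all }x\in\overline{A}_{r_1,r_2}.$$ Now let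 $U\subset\mathbb{R}^d$ be open and bounded, and let $r_0>0$ be such that for every $x\in\partial U$ there is $x^*\in\mathbb{R}^d$ with $\overline{B}_{r_0}(x^*)\cap\overline{U}=\{x\}$. For a set $V$ and $\delta>0$ write $V_\delta=\{x\in\mathbb{R}^d : d(x,V)<\delta\}$. (Distances to the empty set are $+\infty$.) 2. There is $C>0$, depending only on $d,\nu,U,r_0$, such that for every $\alpha\in[\frac1{2\nu},2\nu]$ and every $0<\delta<\frac{r_0}{2}$ $$\sup_{d(x,\partial U)\le\delta}E^{W^\alpha_x}(\tau_U)\le C\delta\quad\text{and}\quad\sup_{d(x,\partial U_\delta)\le 2\delta}E^{W^\alpha_x}(\tau_{U_\delta})<C\delta.$$ 3. There is $C>0$, depending only on $d,\nu,U,r_0$, such that for every $\alpha\in[\frac1{2\nu},2\nu]$, every $\epsilon>0$ and every $0<\delta<\frac{r_0}{2\epsilon}$ $$\sup_{d(x,\partial (U/\epsilon))\le\delta}E^{W^\alpha_x}(\tau_{U/\epsilon})\le C\epsilon^{-1}\delta\quad\text{and}\quad\sup_{d(x,\partial ((U/\epsilon)_\delta))\le 2\delta}E^{W^\alpha_x}(\tau_{(U/\epsilon)_\delta})<C\epsilon^{-1}\delta.$$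 -/

import Mathlib

open MeasureTheory ProbabilityTheory Metric Set
open scoped NNReal ENNReal Pointwise

/-- The space `C([0,∞); ℝᵈ)` of continuous paths. -/
abbrev PathSpace (d : ℕ) : Type := C(ℝ≥0, EuclideanSpace ℝ (Fin d))

/-- The σ-algebra on path space generated by the canonical process, that is, by the evaluations
`X ↦ X t`. -/
instance PathSpace.instMeasurableSpace (d : ℕ) : MeasurableSpace (PathSpace d) :=
  MeasurableSpace.comap (fun (X : PathSpace d) (t : ℝ≥0) ↦ X t) MeasurableSpace.pi

/-- `W` is the Wiener measure of Brownian motion with variance `α` started at `x`: under `W` the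
canonical process is `X t = x + √α B t` with `B` a standard `d`-dimensional Brownian motion, that is,
the coordinates of `(X - x) / √α` are independent standard real Brownian motions. -/
structure IsWienerMeasure {d : ℕ} (α : ℝ) (x : EuclideanSpace ℝ (Fin d))
    (W : Measure (PathSpace d)) : Prop where
  coord : ∀ i : Fin d, IsBrownianReal (fun t (X : PathSpace d) ↦ (X t i - x i) / √α) W
  indep : iIndepFun (fun (i : Fin d) (X : PathSpace d) (t : ℝ≥0) ↦ (X t i - x i) / √α) W

/-- The exit time `inf {t ≥ 0 | X t ∉ V}` of a path from a set, equal to `∞` if there is no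
such `t`. -/
noncomputable def exitTime {d : ℕ} (V : Set (EuclideanSpace ℝ (Fin d))) (X : PathSpace d) : ℝ≥0∞ :=
  ⨅ (t : ℝ≥0) (_ : X t ∉ V), (t : ℝ≥0∞)

/-- The expectation under `W` of the exit time from `V`. -/
noncomputable def expectedExitTime {d : ℕ} (W : Measure (PathSpace d))
    (V : Set (EuclideanSpace ℝ (Fin d))) : ℝ≥0∞ :=
  ∫⁻ X, exitTime V X ∂W

/-- The open annulus `B_{r₂} \ closure B_{r₁}` centred at the origin. -/
def annulus (d : ℕ) (r₁ r₂ : ℝ) : Set (EuclideanSpace ℝ (Fin d)) :=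
  ball 0 r₂ \ closedBall 0 r₁

/-- The exterior ball condition with radius `r₀`. -/
def ExteriorBallCondition {d : ℕ} (U : Set (EuclideanSpace ℝ (Fin d))) (r₀ : ℝ) : Prop :=
  ∀ x ∈ frontier U, ∃ y : EuclideanSpace ℝ (Fin d), closedBall y r₀ ∩ closure U = {x}

/-! The proof is a barrier argument. With `l = d / r₁ ^ 2`, the function u(y) = 1 - exp(-l‖y‖²)
satisfies (α/2)Δu ≤ -αld exp(-l‖y‖²) for ‖y‖ ≥ r₁, because there l‖y‖² ≥ d. On the annulus u
therefore decreases in mean at least at rate κ = `barrierRate`, which is half of the worst rate, the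
other half being room for discretization. Stopping at the exit time τ from a set V inside an annulus
centred at c gives κ E τ + a ≤ u(x - c), where a is the value of u on the inner sphere. Since u is
Lipschitz in the radius, E τ is at most a constant times `dist x c - r₁`.

Stochastic calculus is avoided by sampling the path at multiples of h. Explicit Gaussian integrals
and the Markov property at deterministic times make `compensatedBarrier` decrease in mean
(`lintegral_compensatedBarrier_le`). Path continuity and Fatou's lemma then let h tend to 0
(`exitTime_add_le_liminf_compensatedBarrier`, `expectedExitTime_le_of_subset_annulus`).

For a domain, a point near the boundary is compared with the exterior ball touching at a nearby
boundary point. Both U and U_δ lie in an annulus about its centre with inner radius r₀ - δ > r₀/2,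
and the starting point is within 4δ of the inner sphere. The scaled estimate is the same one applied
to `ε⁻¹ • U`, because the constant is homogeneous of degree one in the lengths. -/

/-! ### Gaussian averages of a Gaussian bump. -/

/-- The Gaussian mean of a Gaussian bump in one dimension. -/
lemma integral_exp_neg_mul_sq_gaussianReal {l : ℝ} (hl : 0 ≤ l) (y a : ℝ) {h : ℝ≥0} (hh : h ≠ 0) :
    ∫ z, Real.exp (-l * (y + a * z) ^ 2) ∂gaussianReal 0 h =
      (√(1 + 2 * l * a ^ 2 * h))⁻¹ * Real.exp (-l * y ^ 2 / (1 + 2 * l * a ^ 2 * h)) := by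
  have hpos : (0 : ℝ) < h := by positivity
  set q : ℝ := 1 + 2 * l * a ^ 2 * h with hq
  have hq0 : 0 < q := by positivity
  rw [integral_gaussianReal_eq_integral_smul hh]
  -- Complete the square in z.
  have key : ∀ z : ℝ, gaussianPDFReal 0 h z • Real.exp (-l * (y + a * z) ^ 2) =
      ((√(2 * Real.pi * h))⁻¹ * Real.exp (-l * y ^ 2 / q)) *
        Real.exp (-(q / (2 * h)) * (z + 2 * l * a * y * h / q) ^ 2) := by
    intro z
    rw [gaussianPDFReal, smul_eq_mul, mul_assoc (√(2 * Real.pi * h))⁻¹ (Real.exp _),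
      mul_assoc (√(2 * Real.pi * h))⁻¹ (Real.exp _), ← Real.exp_add, ← Real.exp_add]
    congr 2
    field_simp
    rw [hq]
    ring
  simp_rw [key]
  rw [integral_const_mul,
    integral_add_right_eq_self (fun z : ℝ ↦ Real.exp (-(q / (2 * h)) * z ^ 2)), integral_gaussian]
  have h1 : √(Real.pi / (q / (2 * h))) = √(2 * Real.pi * h) * (√q)⁻¹ := by
    rw [← Real.sqrt_inv, ← Real.sqrt_mul (by positivity)]
    congr 1
    field_simp
  rw [h1]
  have : √(2 * Real.pi * h) ≠ 0 := by positivity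
  field_simp

/-- The Gaussian mean of a Gaussian bump. -/
lemma integral_exp_neg_mul_norm_sq_pi_gaussianReal {d : ℕ} {l : ℝ} (hl : 0 ≤ l)
    (y : EuclideanSpace ℝ (Fin d)) (a : ℝ) {h : ℝ≥0} (hh : h ≠ 0) :
    ∫ z, Real.exp (-l * ‖y + a • WithLp.toLp 2 z‖ ^ 2)
        ∂(Measure.pi fun _ : Fin d ↦ gaussianReal 0 h) =
      (√(1 + 2 * l * a ^ 2 * h))⁻¹ ^ d *
        Real.exp (-l * ‖y‖ ^ 2 / (1 + 2 * l * a ^ 2 * h)) := by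
  have : ∀ z : Fin d → ℝ, Real.exp (-l * ‖y + a • WithLp.toLp 2 z‖ ^ 2) =
      ∏ i, Real.exp (-l * (y i + a * z i) ^ 2) := by
    intro z
    rw [← Real.exp_sum, EuclideanSpace.real_norm_sq_eq, Finset.mul_sum]
    simp
  simp_rw [this]
  rw [integral_fintype_prod_eq_prod (fun i z ↦ Real.exp (-l * (y i + a * z) ^ 2))]
  simp_rw [integral_exp_neg_mul_sq_gaussianReal hl _ a hh]
  rw [Finset.prod_mul_distrib, ← Real.exp_sum, EuclideanSpace.real_norm_sq_eq, Finset.mul_sum,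
    Finset.sum_div]
  simp

/-- The Gaussian bump `exp (-d ‖y‖² / r₁²)` is strictly subharmonic away from the ball of radius
`r₁`, in terms of short-time Gaussian averages. -/
lemma exp_add_le_integral_exp_neg_norm_sq {d : ℕ} {r₁ r₂ α : ℝ} (hr₁ : 0 < r₁) (hα : 0 < α)
    {y : EuclideanSpace ℝ (Fin d)} (h₁ : r₁ ≤ ‖y‖) (h₂ : ‖y‖ ≤ r₂) {h : ℝ≥0} (hh : h ≠ 0)
    (hsmall : 6 * (d / r₁ ^ 2) * α * h ≤ 1) :
    Real.exp (-(d / r₁ ^ 2) * ‖y‖ ^ 2) +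
        Real.exp (-(d / r₁ ^ 2) * r₂ ^ 2) * ((d / r₁ ^ 2) * d * α / 2) * h ≤
      ∫ z, Real.exp (-(d / r₁ ^ 2) * ‖y + √α • WithLp.toLp 2 z‖ ^ 2)
        ∂(Measure.pi fun _ : Fin d ↦ gaussianReal 0 h) := by
  have hpos : (0 : ℝ) < h := by positivity
  set l : ℝ := d / r₁ ^ 2 with hl
  have hl0 : 0 ≤ l := by positivity
  rw [integral_exp_neg_mul_norm_sq_pi_gaussianReal hl0 _ _ hh, Real.sq_sqrt hα.le]
  set s : ℝ := α * h with hs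
  have hs0 : 0 < s := by positivity
  set q : ℝ := 1 + 2 * l * α * h with hq
  have hq' : q = 1 + 2 * l * s := by rw [hq, hs]; ring
  have hsm : 2 * l * s ≤ 1 / 3 := by rw [hs]; linarith
  have hq1 : 1 ≤ q := by rw [hq']; nlinarith [mul_nonneg hl0 hs0.le]
  have hq0 : 0 < q := by linarith
  have hq43 : q ≤ 4 / 3 := by linarith
  -- This is 1 + t ≤ exp t at t = 2ls.
  have hsqrt : Real.exp (-(l * s)) ≤ (√q)⁻¹ := by
    rw [Real.exp_neg]
    apply inv_anti₀ (by positivity)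
    rw [Real.sqrt_le_left (by positivity), ← Real.exp_nat_mul]
    have := Real.add_one_le_exp (2 * l * s)
    push_cast
    rw [← mul_assoc]
    linarith
  have hd : Real.exp (-(l * s) * d) ≤ (√q)⁻¹ ^ d := by
    rw [mul_comm, Real.exp_nat_mul]
    exact pow_le_pow_left₀ (by positivity) hsqrt d
  have hly : (d : ℝ) ≤ l * ‖y‖ ^ 2 := by
    have h3 : r₁ ^ 2 ≤ ‖y‖ ^ 2 := by gcongr
    calc (d : ℝ) = l * r₁ ^ 2 := by rw [hl]; field_simp
      _ ≤ _ := by gcongr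
  -- The prefactor costs lsd in the exponent. Dividing by q gains 2ls · l‖y‖²/q ≥ (3/2)lsd, as l‖y‖²
  -- ≥ d and q ≤ 4/3. The net gain is lsd/2.
  have hexp : -l * ‖y‖ ^ 2 + l * s * d / 2 ≤ -(l * s) * d + -l * ‖y‖ ^ 2 / q := by
    have h4 : -l * ‖y‖ ^ 2 / q = -l * ‖y‖ ^ 2 + 2 * l * s * (l * ‖y‖ ^ 2 / q) := by
      field_simp
      rw [hq']
      ring
    have h5 : 3 / 4 * (d : ℝ) ≤ l * ‖y‖ ^ 2 / q := by
      rw [le_div_iff₀ hq0]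
      have : (0 : ℝ) ≤ d := by positivity
      nlinarith
    rw [h4]
    nlinarith [mul_le_mul_of_nonneg_left h5 (mul_nonneg hl0 hs0.le)]
  calc Real.exp (-l * ‖y‖ ^ 2) + Real.exp (-l * r₂ ^ 2) * (l * d * α / 2) * h
      ≤ Real.exp (-l * ‖y‖ ^ 2) + Real.exp (-l * ‖y‖ ^ 2) * (l * d * α / 2) * h := by
        have : -l * r₂ ^ 2 ≤ -l * ‖y‖ ^ 2 := by
          have : ‖y‖ ^ 2 ≤ r₂ ^ 2 := by gcongr
          nlinarith
        gcongr
    _ = Real.exp (-l * ‖y‖ ^ 2) * (l * s * d / 2 + 1) := by rw [hs]; ring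
    _ ≤ Real.exp (-l * ‖y‖ ^ 2) * Real.exp (l * s * d / 2) := by
        gcongr
        exact Real.add_one_le_exp _
    _ ≤ Real.exp (-(l * s) * d + -l * ‖y‖ ^ 2 / q) := by
        rw [← Real.exp_add]
        exact Real.exp_le_exp.2 hexp
    _ ≤ _ := by
        rw [Real.exp_add]
        gcongr

/-! ### The barrier and its rate of decrease. -/

/-- A bounded function that is superharmonic on the annulus of radii `r₁` and `r₂`. -/
noncomputable def barrier (d : ℕ) (r₁ : ℝ) (y : EuclideanSpace ℝ (Fin d)) : ℝ :=
  1 - Real.exp (-(d / r₁ ^ 2) * ‖y‖ ^ 2)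

/-- The rate at which Brownian motion of variance `α` decreases `barrier` on the annulus of radii
`r₁` and `r₂`. -/
noncomputable def barrierRate (d : ℕ) (r₁ r₂ α : ℝ) : ℝ :=
  Real.exp (-(d / r₁ ^ 2) * r₂ ^ 2) * ((d / r₁ ^ 2) * d * α / 2)

lemma barrier_nonneg {d : ℕ} {r₁ : ℝ} (y : EuclideanSpace ℝ (Fin d)) : 0 ≤ barrier d r₁ y := by
  rw [barrier, sub_nonneg, Real.exp_le_one_iff]
  have : 0 ≤ (d / r₁ ^ 2 : ℝ) * ‖y‖ ^ 2 := by positivity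
  linarith

lemma continuous_barrier (d : ℕ) (r₁ : ℝ) : Continuous (barrier d r₁) := by
  unfold barrier
  fun_prop

lemma barrierRate_pos {d : ℕ} (hd : 0 < d) {r₁ α : ℝ} (hr₁ : 0 < r₁) (hα : 0 < α) (r₂ : ℝ) :
    0 < barrierRate d r₁ r₂ α := by
  unfold barrierRate
  positivity

/-- One time step of the supermartingale inequality; `b` stands for the compensation already
accumulated. -/
lemma lintegral_barrier_add_le {d : ℕ} {r₁ r₂ α : ℝ} (hr₁ : 0 < r₁) (hα : 0 < α)
    {y : EuclideanSpace ℝ (Fin d)} (h₁ : r₁ ≤ ‖y‖) (h₂ : ‖y‖ ≤ r₂) {h : ℝ≥0} (hh : h ≠ 0)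
    (hsmall : 6 * (d / r₁ ^ 2) * α * h ≤ 1) (b : ℝ) (hb : 0 ≤ b) :
    ∫⁻ z, ENNReal.ofReal (b + barrierRate d r₁ r₂ α * h +
        barrier d r₁ (y + √α • WithLp.toLp 2 z))
        ∂(Measure.pi fun _ : Fin d ↦ gaussianReal 0 h) ≤
      ENNReal.ofReal (b + barrier d r₁ y) := by
  have hint : Integrable (fun z : Fin d → ℝ ↦
      Real.exp (-(d / r₁ ^ 2) * ‖y + √α • WithLp.toLp 2 z‖ ^ 2))
      (Measure.pi fun _ : Fin d ↦ gaussianReal 0 h) := by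
    refine Integrable.of_bound (C := 1)
      (Continuous.aestronglyMeasurable (by fun_prop)) (ae_of_all _ fun z ↦ ?_)
    rw [Real.norm_eq_abs, Real.abs_exp, Real.exp_le_one_iff, neg_mul, neg_nonpos]
    positivity
  have key := exp_add_le_integral_exp_neg_norm_sq hr₁ hα h₁ h₂ hh hsmall
  have hrate : 0 ≤ barrierRate d r₁ r₂ α := by unfold barrierRate; positivity
  rw [← ofReal_integral_eq_lintegral_ofReal]
  · apply ENNReal.ofReal_le_ofReal
    unfold barrier barrierRate
    rw [integral_add (integrable_const _) (by exact (integrable_const _).sub hint),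
      integral_sub (integrable_const _) hint]
    simp only [integral_const, probReal_univ, one_smul]
    linarith
  · unfold barrier
    exact (integrable_const _).add ((integrable_const _).sub hint)
  · refine ae_of_all _ fun z ↦ ?_
    have := barrier_nonneg (r₁ := r₁) (y + √α • WithLp.toLp 2 z)
    simp only [Pi.zero_apply]
    positivity

/-- The barrier bound, in terms of the distance to the inner sphere. -/
lemma barrier_sub_div_barrierRate_le {d : ℕ} (hd : 0 < d) {r₁ r₂ α ρ : ℝ} (hr₁ : 0 < r₁)
    (hα : 0 < α) (h₁ : r₁ ≤ ρ) (h₂ : ρ ≤ r₂) :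
    (Real.exp (-(d / r₁ ^ 2) * r₁ ^ 2) - Real.exp (-(d / r₁ ^ 2) * ρ ^ 2)) /
        barrierRate d r₁ r₂ α ≤
      4 * α⁻¹ * r₂ * Real.exp ((d / r₁ ^ 2) * r₂ ^ 2) * (ρ - r₁) := by
  set l : ℝ := d / r₁ ^ 2 with hl
  have hl0 : 0 < l := by positivity
  have hd1 : (1 : ℝ) ≤ d := by exact_mod_cast hd
  have h3 : Real.exp (-l * r₁ ^ 2) - Real.exp (-l * ρ ^ 2) ≤ l * (ρ ^ 2 - r₁ ^ 2) := by
    have e1 : Real.exp (-l * ρ ^ 2) =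
        Real.exp (-l * r₁ ^ 2) * Real.exp (-(l * (ρ ^ 2 - r₁ ^ 2))) := by
      rw [← Real.exp_add]; congr 1; ring
    have e2 : Real.exp (-l * r₁ ^ 2) ≤ 1 := by
      rw [Real.exp_le_one_iff, neg_mul, neg_nonpos]; positivity
    have e3 := Real.one_sub_le_exp_neg (l * (ρ ^ 2 - r₁ ^ 2))
    have e4 : 0 ≤ l * (ρ ^ 2 - r₁ ^ 2) := by
      apply mul_nonneg hl0.le
      nlinarith
    rw [e1]
    nlinarith [Real.exp_pos (-l * r₁ ^ 2)]
  rw [div_le_iff₀ (barrierRate_pos hd hr₁ hα r₂), barrierRate, ← hl]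
  refine h3.trans ?_
  have h4 : 4 * α⁻¹ * r₂ * Real.exp (l * r₂ ^ 2) * (ρ - r₁) *
      (Real.exp (-l * r₂ ^ 2) * (l * d * α / 2)) = 2 * r₂ * (ρ - r₁) * l * d := by
    rw [neg_mul, Real.exp_neg]
    field_simp
    ring
  rw [h4]
  have h5 : ρ ^ 2 - r₁ ^ 2 ≤ 2 * r₂ * (ρ - r₁) := by nlinarith
  have h6 : 0 ≤ 2 * r₂ * (ρ - r₁) * l := by
    have : 0 ≤ ρ - r₁ := by linarith
    have : 0 ≤ r₂ := by linarith
    positivity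
  nlinarith

/-! ### The Markov property on path space. -/

lemma measurable_pathSpace_eval {d : ℕ} (t : ℝ≥0) :
    Measurable fun X : PathSpace d ↦ X t :=
  (measurable_pi_apply t).comp (comap_measurable _)

lemma measurable_pathSpace_eval_coord {d : ℕ} (t : ℝ≥0) (i : Fin d) :
    Measurable fun X : PathSpace d ↦ X t i :=
  (EuclideanSpace.proj i : _ →L[ℝ] ℝ).continuous.measurable.comp (measurable_pathSpace_eval t)

/-- The normalized path up to time `s`, stopped at time `s`. -/
noncomputable def normalizedPast {d : ℕ} (α : ℝ) (x : EuclideanSpace ℝ (Fin d)) (s : ℝ≥0)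
    (X : PathSpace d) : Fin d → ℝ≥0 → ℝ :=
  fun i r ↦ (X (min r s) i - x i) / √α

/-- The normalized increment of a path between the times `s` and `s + t`. -/
noncomputable def normalizedIncrement {d : ℕ} (α : ℝ) (s t : ℝ≥0) (X : PathSpace d) :
    Fin d → ℝ :=
  fun i ↦ (X (s + t) i - X s i) / √α

lemma measurable_normalizedPast {d : ℕ} (α : ℝ) (x : EuclideanSpace ℝ (Fin d)) (s : ℝ≥0) :
    Measurable (normalizedPast α x s) := by
  refine measurable_pi_lambda _ fun i ↦ measurable_pi_lambda _ fun r ↦ ?_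
  exact ((measurable_pathSpace_eval_coord _ i).sub_const _).div_const _

lemma measurable_normalizedIncrement {d : ℕ} (α : ℝ) (s t : ℝ≥0) :
    Measurable (normalizedIncrement (d := d) α s t) := by
  refine measurable_pi_lambda _ fun i ↦ ?_
  exact ((measurable_pathSpace_eval_coord _ i).sub (measurable_pathSpace_eval_coord _ i)).div_const _

namespace IsWienerMeasure

variable {d : ℕ} {α : ℝ} {x : EuclideanSpace ℝ (Fin d)} {W : Measure (PathSpace d)}

lemma isProbabilityMeasure (hW : IsWienerMeasure α x W) : IsProbabilityMeasure W :=
  hW.indep.isProbabilityMeasure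

lemma ae_eval_zero (hW : IsWienerMeasure α x W) (hα : 0 < α) : ∀ᵐ X ∂W, X 0 = x := by
  have : ∀ᵐ X ∂W, ∀ i, (X 0 i - x i) / √α = 0 :=
    ae_all_iff.2 fun i ↦ (hW.coord i).eval_zero_ae_eq_zero
  filter_upwards [this] with X hX
  ext i
  have h0 : √α ≠ 0 := by positivity
  have := hX i
  rw [div_eq_zero_iff] at this
  rcases this with h | h
  · linarith
  · exact absurd h h0

lemma hasLaw_normalizedIncrement (hW : IsWienerMeasure α x W) (s t : ℝ≥0) :
    HasLaw (normalizedIncrement α s t) (Measure.pi fun _ ↦ gaussianReal 0 t) W := by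
  have hcoord : ∀ i, HasLaw (fun X : PathSpace d ↦ normalizedIncrement α s t X i)
      (gaussianReal 0 t) W := by
    intro i
    have h := ((hW.coord i).shift s).hasLaw_eval t
    refine h.congr (ae_of_all _ fun X ↦ ?_)
    simp only [normalizedIncrement]
    ring
  refine iIndepFun.hasLaw_pi hcoord ?_
  have := hW.indep.comp (fun i (p : ℝ≥0 → ℝ) ↦ p (s + t) - p s) (fun i ↦ by fun_prop)
  refine (iIndepFun_congr fun i ↦ ae_of_all _ fun X ↦ ?_).1 this
  simp only [normalizedIncrement, Function.comp_apply]
  ring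

/-- Independence across coordinates and, within each coordinate, of past and future combine into
joint independence of the family indexed by `Fin d × Bool`. Grouping it by the Boolean separates
past from future. -/
lemma indepFun_past_increment (hW : IsWienerMeasure α x W) (s t : ℝ≥0) :
    IndepFun (normalizedPast α x s) (normalizedIncrement α s t) W := by
  let Y : Fin d → Bool → PathSpace d → ℝ≥0 → ℝ := fun i b X r ↦
    bif b then (X (s + r) i - X s i) / √α else (X (min r s) i - x i) / √α
  have hY : ∀ i b, Measurable (Y i b) := by
    intro i b
    refine measurable_pi_lambda _ fun r ↦ ?_
    cases b
    · exact ((measurable_pathSpace_eval_coord _ i).sub_const _).div_const _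
    · exact ((measurable_pathSpace_eval_coord _ i).sub
        (measurable_pathSpace_eval_coord _ i)).div_const _
  have h1 : iIndepFun (fun i X ↦ (Y i · X)) W := by
    have := hW.indep.comp (fun i (p : ℝ≥0 → ℝ) (b : Bool) (r : ℝ≥0) ↦
      bif b then p (s + r) - p s else p (min r s)) (fun i ↦ by
        refine measurable_pi_lambda _ fun b ↦ measurable_pi_lambda _ fun r ↦ ?_
        cases b <;> simp <;> fun_prop)
    refine (iIndepFun_congr fun i ↦ ae_of_all _ fun X ↦ ?_).1 this
    ext b r
    cases b
    · simp [Y]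
    · simp [Y]; ring
  have h2 : ∀ i, iIndepFun (Y i) W := by
    intro i
    have hind := ((hW.coord i).indepFun_shift s).symm.comp
      (φ := fun (p : Iic s → ℝ) (r : ℝ≥0) ↦ p ⟨min r s, mem_Iic.2 (min_le_right r s)⟩)
      (ψ := id) (measurable_pi_lambda _ fun r ↦ measurable_pi_apply _) measurable_id
    have hY' : IndepFun (Y i false) (Y i true) W := by
      refine hind.congr (ae_of_all _ fun X ↦ ?_) (ae_of_all _ fun X ↦ ?_)
      · ext r; simp [Y]
      · ext r; simp [Y]; ring
    have := hW.isProbabilityMeasure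
    rw [iIndepFun_iff_map_fun_eq_pi_map fun b ↦ (hY i b).aemeasurable]
    have : ∀ b, IsProbabilityMeasure (W.map (Y i b)) :=
      fun b ↦ Measure.isProbabilityMeasure_map (hY i b).aemeasurable
    refine (Measure.pi_eq fun S hS ↦ ?_).symm
    rw [Measure.map_apply (measurable_pi_lambda _ fun b ↦ hY i b) (.univ_pi hS),
      Fintype.prod_bool, Measure.map_apply (hY i _) (hS _), Measure.map_apply (hY i _) (hS _),
      mul_comm, ← hY'.measure_inter_preimage_eq_mul _ _ (hS _) (hS _)]
    congr 1
    ext X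
    simp only [mem_preimage, mem_univ_pi, Bool.forall_bool, mem_inter_iff]
    rfl
  have h3 := iIndepFun_uncurry' hY h1 h2
  have h4 := h3.indepFun_finset (Finset.univ.image fun i ↦ (i, false))
    (Finset.univ.image fun i ↦ (i, true))
    (by rw [Finset.disjoint_left]; simp) (fun p ↦ hY p.1 p.2)
  exact h4.comp
    (φ := fun q (i : Fin d) (r : ℝ≥0) ↦ q ⟨(i, false), Finset.mem_image_of_mem _ (Finset.mem_univ i)⟩ r)
    (ψ := fun q (i : Fin d) ↦ q ⟨(i, true), Finset.mem_image_of_mem _ (Finset.mem_univ i)⟩ t)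
    (measurable_pi_lambda _ fun i ↦ measurable_pi_lambda _ fun r ↦
      (measurable_pi_apply r).comp (measurable_pi_apply _))
    (measurable_pi_lambda _ fun i ↦ (measurable_pi_apply t).comp (measurable_pi_apply _))

/-- The Markov property at a deterministic time. -/
lemma setLIntegral_eval_add (hW : IsWienerMeasure α x W) (hα : 0 < α) (s t : ℝ≥0)
    {φ : EuclideanSpace ℝ (Fin d) → ℝ≥0∞} (hφ : Measurable φ) {F : Set (PathSpace d)}
    (hF : MeasurableSet[MeasurableSpace.comap (normalizedPast α x s) inferInstance] F) :
    ∫⁻ X in F, φ (X (s + t)) ∂W =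
      ∫⁻ X in F, ∫⁻ z, φ (X s + √α • WithLp.toLp 2 z)
        ∂(Measure.pi fun _ : Fin d ↦ gaussianReal 0 t) ∂W := by
  have := hW.isProbabilityMeasure
  obtain ⟨S, hS, rfl⟩ := hF
  have h0 : √α ≠ 0 := by positivity
  let Y : (Fin d → ℝ≥0 → ℝ) → EuclideanSpace ℝ (Fin d) := fun p ↦
    x + √α • WithLp.toLp 2 fun i ↦ p i s
  have hY : Measurable Y := by fun_prop
  have hYs : ∀ X : PathSpace d, Y (normalizedPast α x s X) = X s := by
    intro X
    ext i
    simp [Y, normalizedPast]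
    field_simp
    ring
  have hYt : ∀ X : PathSpace d, X s + √α • WithLp.toLp 2 (normalizedIncrement α s t X) =
      X (s + t) := by
    intro X
    ext i
    simp [normalizedIncrement]
    field_simp
    ring
  -- Both sides are integrals of this function of (past, increment): the left against the joint law,
  -- the right against the product of the marginals.
  let Φ : (Fin d → ℝ≥0 → ℝ) × (Fin d → ℝ) → ℝ≥0∞ :=
    (S ×ˢ univ).indicator fun p ↦ φ (Y p.1 + √α • WithLp.toLp 2 p.2)
  have hΦ : Measurable Φ := by
    refine Measurable.indicator ?_ (hS.prod .univ)
    fun_prop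
  have hP := measurable_normalizedPast α x s
  have hI := measurable_normalizedIncrement (d := d) α s t
  rw [← lintegral_indicator (hP hS), ← lintegral_indicator (hP hS)]
  calc _ = ∫⁻ X, Φ (normalizedPast α x s X, normalizedIncrement α s t X) ∂W := by
        refine lintegral_congr fun X ↦ ?_
        by_cases hX : normalizedPast α x s X ∈ S
        · rw [indicator_of_mem (show X ∈ normalizedPast α x s ⁻¹' S from hX)]
          simp only [Φ]
          rw [indicator_of_mem (by simpa using hX)]
          simp only [hYs, hYt]
        · rw [indicator_of_notMem (show X ∉ normalizedPast α x s ⁻¹' S from hX)]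
          simp only [Φ]
          rw [indicator_of_notMem (by simpa using hX)]
    _ = ∫⁻ p, Φ p ∂(W.map fun X ↦ (normalizedPast α x s X, normalizedIncrement α s t X)) :=
        (lintegral_map hΦ (hP.prodMk hI)).symm
    _ = ∫⁻ p, ∫⁻ z, Φ (p, z) ∂(Measure.pi fun _ : Fin d ↦ gaussianReal 0 t)
          ∂(W.map (normalizedPast α x s)) := by
        rw [(indepFun_iff_map_prod_eq_prod_map_map hP.aemeasurable hI.aemeasurable).1
          (hW.indepFun_past_increment s t), (hW.hasLaw_normalizedIncrement s t).map_eq,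
          lintegral_prod _ hΦ.aemeasurable]
    _ = _ := by
        rw [lintegral_map hΦ.lintegral_prod_right' hP]
        refine lintegral_congr fun X ↦ ?_
        by_cases hX : normalizedPast α x s X ∈ S
        · rw [indicator_of_mem (show X ∈ normalizedPast α x s ⁻¹' S from hX)]
          simp only [Φ]
          refine lintegral_congr fun z ↦ ?_
          rw [indicator_of_mem (by simpa using hX)]
          simp only [hYs]
        · rw [indicator_of_notMem (show X ∉ normalizedPast α x s ⁻¹' S from hX)]
          simp only [Φ]
          rw [← lintegral_zero]
          refine lintegral_congr fun z ↦ ?_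
          rw [indicator_of_notMem (by simpa using hX)]

end IsWienerMeasure

/-! ### First exit of the sampled path. -/

open Classical in
/-- The index of the first exit from `V` of the path sampled at the multiples of `h`, capped at
`N`. -/
noncomputable def stoppedIndex {d : ℕ} (V : Set (EuclideanSpace ℝ (Fin d))) (h : ℝ≥0) :
    ℕ → PathSpace d → ℕ
  | 0, _ => 0
  | N + 1, X => if stoppedIndex V h N X = N ∧ X (N * h) ∈ V then N + 1 else stoppedIndex V h N X

section stoppedIndex

variable {d : ℕ} {V : Set (EuclideanSpace ℝ (Fin d))} {h : ℝ≥0}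

lemma stoppedIndex_le (N : ℕ) (X : PathSpace d) : stoppedIndex V h N X ≤ N := by
  induction N with
  | zero => simp [stoppedIndex]
  | succ N ih =>
    rw [stoppedIndex]
    split_ifs <;> omega

lemma eval_mem_of_lt_stoppedIndex {N : ℕ} {X : PathSpace d} {k : ℕ}
    (hk : k < stoppedIndex V h N X) : X (k * h) ∈ V := by
  induction N with
  | zero => simp [stoppedIndex] at hk
  | succ N ih =>
    rw [stoppedIndex] at hk
    split_ifs at hk with hc
    · rcases Nat.lt_succ_iff_lt_or_eq.1 hk with h1 | rfl
      · exact ih (by omega)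
      · exact hc.2
    · exact ih hk

lemma eval_notMem_of_stoppedIndex_lt {N : ℕ} {X : PathSpace d}
    (hN : stoppedIndex V h N X < N) : X (stoppedIndex V h N X * h) ∉ V := by
  induction N with
  | zero => simp at hN
  | succ N ih =>
    rw [stoppedIndex] at hN ⊢
    split_ifs at hN ⊢ with hc
    · omega
    · rcases (stoppedIndex_le N X).lt_or_eq with h1 | h1
      · exact ih h1
      · rw [h1]
        exact fun h2 ↦ hc ⟨h1, h2⟩

lemma measurable_eval_comap_normalizedPast {α : ℝ} (hα : 0 < α) (x : EuclideanSpace ℝ (Fin d))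
    {r s : ℝ≥0} (hrs : r ≤ s) :
    Measurable[MeasurableSpace.comap (normalizedPast α x s) inferInstance]
      fun X : PathSpace d ↦ X r := by
  have h0 : √α ≠ 0 := by positivity
  have hY : Measurable fun p : Fin d → ℝ≥0 → ℝ ↦ x + √α • WithLp.toLp 2 fun i ↦ p i r := by
    fun_prop
  have : (fun X : PathSpace d ↦ X r) =
      (fun p : Fin d → ℝ≥0 → ℝ ↦ x + √α • WithLp.toLp 2 fun i ↦ p i r) ∘ normalizedPast α x s := by
    ext X i
    simp [normalizedPast, hrs]
    field_simp
    ring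
  rw [this]
  exact hY.comp (comap_measurable _)

lemma measurable_stoppedIndex_comap_normalizedPast (hV : MeasurableSet V) {α : ℝ} (hα : 0 < α)
    (x : EuclideanSpace ℝ (Fin d)) (N : ℕ) {s : ℝ≥0} (hs : N * h ≤ s) :
    Measurable[MeasurableSpace.comap (normalizedPast α x s) inferInstance]
      (stoppedIndex V h N) := by
  induction N with
  | zero => exact measurable_const
  | succ N ih =>
    have hN : N * h ≤ s := le_trans (by gcongr; simp) hs
    refine Measurable.ite ?_ measurable_const (ih hN)
    exact (ih hN (measurableSet_singleton N)).inter
      (measurable_eval_comap_normalizedPast hα x hN hV)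

/-- The event that the sampled path still moves at step `N` is decided by time `N * h`, so the
Markov property applies on it. -/
lemma measurableSet_stoppedIndex_eq_and_mem (hV : MeasurableSet V) {α : ℝ} (hα : 0 < α)
    (x : EuclideanSpace ℝ (Fin d)) (N : ℕ) :
    MeasurableSet[MeasurableSpace.comap (normalizedPast α x (N * h)) inferInstance]
      {X | stoppedIndex V h N X = N ∧ X (N * h) ∈ V} :=
  (measurable_stoppedIndex_comap_normalizedPast hV hα x N le_rfl (measurableSet_singleton N)).inter
    (measurable_eval_comap_normalizedPast hα x le_rfl hV)

end stoppedIndex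

/-! ### The discrete supermartingale and its continuous-time limit. -/

/-- The value of the barrier at the stopped sampled path, compensated by the elapsed time. -/
noncomputable def compensatedBarrier {d : ℕ} (V : Set (EuclideanSpace ℝ (Fin d)))
    (c : EuclideanSpace ℝ (Fin d)) (r₁ κ : ℝ) (h : ℝ≥0) (N : ℕ) (X : PathSpace d) : ℝ≥0∞ :=
  ENNReal.ofReal (κ * (stoppedIndex V h N X * h) + barrier d r₁ (X (stoppedIndex V h N X * h) - c))

section compensatedBarrier

variable {d : ℕ} {V : Set (EuclideanSpace ℝ (Fin d))} {c x : EuclideanSpace ℝ (Fin d)}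
  {r₁ r₂ α κ : ℝ} {h : ℝ≥0} {W : Measure (PathSpace d)}

open Classical in
lemma compensatedBarrier_succ (N : ℕ) (X : PathSpace d) :
    compensatedBarrier V c r₁ κ h (N + 1) X =
      if stoppedIndex V h N X = N ∧ X (N * h) ∈ V then
        ENNReal.ofReal (κ * ((N + 1) * h) + barrier d r₁ (X ((N + 1) * h) - c))
      else compensatedBarrier V c r₁ κ h N X := by
  rw [compensatedBarrier, stoppedIndex]
  split_ifs
  · push_cast; rfl
  · rfl

lemma measurable_compensatedBarrier (hV : MeasurableSet V) (N : ℕ) :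
    Measurable (compensatedBarrier V c r₁ κ h N) := by
  have hb : Measurable (barrier d r₁) := (continuous_barrier d r₁).measurable
  induction N with
  | zero =>
    unfold compensatedBarrier
    simp only [stoppedIndex]
    exact ENNReal.measurable_ofReal.comp (measurable_const.add
      (hb.comp ((measurable_pathSpace_eval _).sub_const _)))
  | succ N ih =>
    simp_rw [funext fun X ↦ compensatedBarrier_succ (V := V) (c := c) (r₁ := r₁) (κ := κ)
      (h := h) N X]
    refine Measurable.ite ?_ ?_ ih
    -- Measurability on path space involves neither variance nor starting point, so the values 1 and
    -- 0 serve.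
    · exact (measurable_normalizedPast 1 0 _).comap_le _
        (measurableSet_stoppedIndex_eq_and_mem hV one_pos 0 N)
    · exact ENNReal.measurable_ofReal.comp (measurable_const.add
        (hb.comp ((measurable_pathSpace_eval _).sub_const _)))

/-- On the event `F` of not having stopped, the Markov property reduces the claim to one Gaussian
step from a point of V. Off `F` nothing changes. -/
lemma lintegral_compensatedBarrier_succ_le (hW : IsWienerMeasure α x W) (hα : 0 < α)
    (hV : MeasurableSet V) (hr₁ : 0 < r₁) (hV₁ : ∀ y ∈ V, r₁ ≤ dist y c)
    (hV₂ : ∀ y ∈ V, dist y c ≤ r₂) (hh : h ≠ 0) (hsmall : 6 * (d / r₁ ^ 2) * α * h ≤ 1) (N : ℕ) :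
    ∫⁻ X, compensatedBarrier V c r₁ (barrierRate d r₁ r₂ α) h (N + 1) X ∂W ≤
      ∫⁻ X, compensatedBarrier V c r₁ (barrierRate d r₁ r₂ α) h N X ∂W := by
  set κ := barrierRate d r₁ r₂ α with hκ
  have hκ0 : 0 ≤ κ := by rw [hκ]; unfold barrierRate; positivity
  set F : Set (PathSpace d) := {X | stoppedIndex V h N X = N ∧ X (N * h) ∈ V} with hF
  have hFm := measurableSet_stoppedIndex_eq_and_mem (h := h) hV hα x N
  have hFm' : MeasurableSet F := (measurable_normalizedPast α x _).comap_le _ hFm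
  rw [← lintegral_add_compl _ hFm', ← lintegral_add_compl (compensatedBarrier V c r₁ κ h N) hFm']
  have hb : Measurable fun y ↦ barrier d r₁ (y - c) :=
    (continuous_barrier d r₁).measurable.comp (measurable_id.sub_const c)
  refine add_le_add ?_ (le_of_eq ?_)
  · let φ : EuclideanSpace ℝ (Fin d) → ℝ≥0∞ := fun y ↦
      ENNReal.ofReal (κ * (N * h) + κ * h + barrier d r₁ (y - c))
    have hφ : Measurable φ := ENNReal.measurable_ofReal.comp (measurable_const.add hb)
    calc ∫⁻ X in F, compensatedBarrier V c r₁ κ h (N + 1) X ∂W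
        = ∫⁻ X in F, φ (X (N * h + h)) ∂W := by
          refine setLIntegral_congr_fun hFm' fun X hX ↦ ?_
          rw [compensatedBarrier_succ, if_pos (by exact hX)]
          simp only [φ]
          rw [add_one_mul, add_one_mul, mul_add]
      _ = ∫⁻ X in F, ∫⁻ z, φ (X (N * h) + √α • WithLp.toLp 2 z)
            ∂(Measure.pi fun _ : Fin d ↦ gaussianReal 0 h) ∂W :=
          hW.setLIntegral_eval_add hα _ _ hφ hFm
      _ ≤ ∫⁻ X in F, compensatedBarrier V c r₁ κ h N X ∂W := by
          refine setLIntegral_mono' hFm' fun X hX ↦ ?_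
          have h1 := hV₁ _ hX.2
          have h2 := hV₂ _ hX.2
          rw [dist_eq_norm] at h1 h2
          rw [compensatedBarrier, hX.1]
          simp only [φ, add_sub_right_comm]
          exact lintegral_barrier_add_le hr₁ hα h1 h2 hh hsmall _ (by positivity)
  · refine setLIntegral_congr_fun hFm'.compl fun X hX ↦ ?_
    rw [compensatedBarrier_succ, if_neg (by exact hX)]

lemma lintegral_compensatedBarrier_le (hW : IsWienerMeasure α x W) (hα : 0 < α)
    (hV : MeasurableSet V) (hr₁ : 0 < r₁) (hV₁ : ∀ y ∈ V, r₁ ≤ dist y c)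
    (hV₂ : ∀ y ∈ V, dist y c ≤ r₂) (hh : h ≠ 0) (hsmall : 6 * (d / r₁ ^ 2) * α * h ≤ 1) (N : ℕ) :
    ∫⁻ X, compensatedBarrier V c r₁ (barrierRate d r₁ r₂ α) h N X ∂W ≤
      ENNReal.ofReal (barrier d r₁ (x - c)) := by
  have := hW.isProbabilityMeasure
  induction N with
  | zero =>
    have : ∀ᵐ X ∂W, compensatedBarrier V c r₁ (barrierRate d r₁ r₂ α) h 0 X =
        ENNReal.ofReal (barrier d r₁ (x - c)) := by
      filter_upwards [hW.ae_eval_zero hα] with X hX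
      simp [compensatedBarrier, stoppedIndex, hX]
    rw [lintegral_congr_ae this]
    simp
  | succ N ih =>
    exact (lintegral_compensatedBarrier_succ_le hW hα hV hr₁ hV₁ hV₂ hh hsmall N).trans ih

lemma exitTime_le {X : PathSpace d} {t : ℝ≥0} (ht : X t ∉ V) : exitTime V X ≤ t :=
  iInf₂_le t ht

/-- The sampled exit comes no earlier than the true one, but it may overshoot to where the barrier
is below `a`. The preceding sample lies in V, so continuity makes this deficit vanish with the mesh.
-/
lemma exitTime_add_le_liminf_compensatedBarrier (hκ : 0 < κ) {a : ℝ} (ha : 0 ≤ a)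
    (hV : ∀ y ∈ V, a ≤ barrier d r₁ (y - c)) {X : PathSpace d} (hX : X 0 ∈ V) :
    ENNReal.ofReal κ * exitTime V X + ENNReal.ofReal a ≤
      Filter.liminf (fun n : ℕ ↦
        compensatedBarrier V c r₁ κ (1 / (n + 1)) ((n + 1) ^ 2) X) Filter.atTop := by
  set Z : ℕ → ℝ≥0∞ := fun n ↦ compensatedBarrier V c r₁ κ (1 / (n + 1)) ((n + 1) ^ 2) X with hZ
  refine ENNReal.le_of_forall_pos_le_add fun η hη hfin ↦ ?_
  set L := Filter.liminf Z Filter.atTop with hL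
  have hη2 : (0 : ℝ≥0∞) < (η / 2 : ℝ≥0) := by
    rw [ENNReal.coe_pos]
    positivity
  have hfreq : ∃ᶠ n in Filter.atTop, Z n < L + (η / 2 : ℝ≥0) :=
    Filter.frequently_lt_of_liminf_lt (by isBoundedDefault)
      (ENNReal.lt_add_right hfin.ne hη2.ne')
  set R : ℝ := (L + (η / 2 : ℝ≥0)).toReal with hR
  have hLR : L + (η / 2 : ℝ≥0) = ENNReal.ofReal R :=
    (ENNReal.ofReal_toReal (ENNReal.add_ne_top.2 ⟨hfin.ne, ENNReal.coe_ne_top⟩)).symm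
  -- Whenever `Z n < R`, the compensator alone forces the sampled stopping time below R/κ, so
  -- uniform continuity is needed only on this compact interval.
  set T : ℝ≥0 := Real.toNNReal (R / κ) with hT
  have hu : UniformContinuousOn (fun t : ℝ≥0 ↦ barrier d r₁ (X t - c)) (Icc 0 T) :=
    isCompact_Icc.uniformContinuousOn_of_continuous
      ((continuous_barrier d r₁).comp (X.continuous.sub continuous_const)).continuousOn
  obtain ⟨δ, hδ, hu⟩ := Metric.uniformContinuousOn_iff.1 hu (η / 2 : ℝ≥0) (by positivity)
  have hev : ∀ᶠ n : ℕ in Filter.atTop, (T : ℝ) < n ∧ 1 / ((n : ℝ) + 1) < δ :=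
    (tendsto_natCast_atTop_atTop.eventually_gt_atTop (T : ℝ)).and
      (tendsto_one_div_add_atTop_nhds_zero_nat.eventually_lt_const hδ)
  obtain ⟨n, hn, hnT, hnδ⟩ := (hfreq.and_eventually hev).exists
  set h : ℝ≥0 := 1 / (n + 1) with hh
  have hh' : (h : ℝ) = 1 / ((n : ℝ) + 1) := by rw [hh]; push_cast; rfl
  set j := stoppedIndex V h ((n + 1) ^ 2) X with hj
  have hb0 := barrier_nonneg (r₁ := r₁) (X (j * h) - c)
  have hZn : Z n = ENNReal.ofReal (κ * (j * h) + barrier d r₁ (X (j * h) - c)) := rfl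
  rw [hLR, hZn, ENNReal.ofReal_lt_ofReal_iff_of_nonneg (by positivity)] at hn
  have hjT : (j * h : ℝ) ≤ R / κ := by
    rw [le_div_iff₀ hκ]
    linarith
  have hjT' : j * h ≤ T := by
    rw [← NNReal.coe_le_coe, hT, Real.coe_toNNReal']
    push_cast
    exact hjT.trans (le_max_left _ _)
  -- The horizon is (n+1)² · h = n+1 > T, so the cap is not reached and the path has really left V
  -- at a sample.
  have hjN : j < (n + 1) ^ 2 := by
    have h1 : (j * h : ℝ) < n := lt_of_le_of_lt (by exact_mod_cast hjT') hnT
    rw [hh', mul_one_div, div_lt_iff₀ (by positivity)] at h1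
    have h2 : (j : ℝ) < ((n + 1) ^ 2 : ℕ) := by push_cast; nlinarith
    exact_mod_cast h2
  have hout := eval_notMem_of_stoppedIndex_lt hjN
  rw [← hj] at hout
  -- The start lies in V, so a preceding sample exists.
  have hj0 : j ≠ 0 := by
    intro h0
    rw [h0] at hout
    simp [hX] at hout
  obtain ⟨i, hi⟩ := Nat.exists_eq_succ_of_ne_zero hj0
  have hin : X (i * h) ∈ V := eval_mem_of_lt_stoppedIndex (N := (n + 1) ^ 2) (by omega)
  have hosc : a - η / 2 ≤ barrier d r₁ (X (j * h) - c) := by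
    have hij : i * h ≤ j * h := by gcongr; omega
    have hd : dist (i * h) (j * h) < δ := by
      rw [NNReal.dist_eq, hi]
      push_cast
      rw [← sub_mul, abs_mul]
      rw [hh', abs_of_pos (show (0 : ℝ) < 1 / ((n : ℝ) + 1) by positivity)]
      simpa using hnδ
    have := hu (i * h) ⟨zero_le, hij.trans hjT'⟩ (j * h) ⟨zero_le, hjT'⟩ hd
    rw [Real.dist_eq, abs_lt] at this
    have h3 := hV _ hin
    push_cast at this
    linarith [this.2]
  calc ENNReal.ofReal κ * exitTime V X + ENNReal.ofReal a
      ≤ ENNReal.ofReal κ * ENNReal.ofReal (j * h) + ENNReal.ofReal a := by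
        gcongr
        refine (exitTime_le hout).trans (le_of_eq ?_)
        rw [ENNReal.ofReal, ENNReal.coe_inj]
        ext
        rw [Real.coe_toNNReal _ (by positivity)]
        push_cast
        rfl
    _ = ENNReal.ofReal (κ * (j * h) + a) := by
        rw [← ENNReal.ofReal_mul hκ.le, ← ENNReal.ofReal_add (by positivity) ha]
    _ ≤ ENNReal.ofReal (R + η / 2) := by
        apply ENNReal.ofReal_le_ofReal
        linarith
    _ = L + η := by
        have : 0 ≤ R := ENNReal.toReal_nonneg
        rw [ENNReal.ofReal_add this (by positivity), ← hLR, add_assoc]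
        congr 1
        have : ENNReal.ofReal ((η : ℝ) / 2) = ((η / 2 : ℝ≥0) : ℝ≥0∞) := by
          rw [ENNReal.ofReal, ENNReal.coe_inj]
          ext
          rw [Real.coe_toNNReal _ (by positivity)]
          push_cast
          rfl
        rw [this, ← ENNReal.coe_add, add_halves]

/-- The expected exit time of Brownian motion from a set contained in an annulus. -/
lemma expectedExitTime_le_of_subset_annulus (hd : 0 < d) (hW : IsWienerMeasure α x W) (hα : 0 < α)
    (hV : MeasurableSet V) (hr₁ : 0 < r₁) (hV₁ : ∀ y ∈ V, r₁ ≤ dist y c)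
    (hV₂ : ∀ y ∈ V, dist y c ≤ r₂) (hx : x ∈ V) :
    expectedExitTime W V ≤ ENNReal.ofReal
      (4 * α⁻¹ * r₂ * Real.exp ((d / r₁ ^ 2) * r₂ ^ 2) * (dist x c - r₁)) := by
  have := hW.isProbabilityMeasure
  set κ := barrierRate d r₁ r₂ α with hκ
  have hκ0 : 0 < κ := barrierRate_pos hd hr₁ hα r₂
  set a : ℝ := 1 - Real.exp (-(d / r₁ ^ 2) * r₁ ^ 2) with ha
  have ha0 : 0 ≤ a := by
    rw [ha, sub_nonneg, Real.exp_le_one_iff, neg_mul, neg_nonpos]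
    positivity
  have hVa : ∀ y ∈ V, a ≤ barrier d r₁ (y - c) := by
    intro y hy
    have h1 := hV₁ y hy
    rw [ha, barrier, ← dist_eq_norm, neg_mul, neg_mul]
    gcongr
  have hmain : ENNReal.ofReal κ * expectedExitTime W V + ENNReal.ofReal a ≤
      ENNReal.ofReal (barrier d r₁ (x - c)) := by
    calc ENNReal.ofReal κ * expectedExitTime W V + ENNReal.ofReal a
        = ∫⁻ X, (ENNReal.ofReal κ * exitTime V X + ENNReal.ofReal a) ∂W := by
          -- Only the constant needs to be measurable here; measurability of `exitTime` is never
          -- used.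
          rw [lintegral_add_right _ measurable_const, lintegral_const_mul' _ _ ENNReal.ofReal_ne_top,
            expectedExitTime]
          simp
      _ ≤ ∫⁻ X, Filter.liminf (fun n : ℕ ↦
            compensatedBarrier V c r₁ κ (1 / (n + 1)) ((n + 1) ^ 2) X) Filter.atTop ∂W := by
          refine lintegral_mono_ae ?_
          filter_upwards [hW.ae_eval_zero hα] with X hX
          exact exitTime_add_le_liminf_compensatedBarrier hκ0 ha0 hVa (hX ▸ hx)
      _ ≤ Filter.liminf (fun n : ℕ ↦ ∫⁻ X,
            compensatedBarrier V c r₁ κ (1 / (n + 1)) ((n + 1) ^ 2) X ∂W) Filter.atTop :=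
          -- Fatou's lemma.
          lintegral_liminf_le fun n ↦ measurable_compensatedBarrier hV _
      _ ≤ Filter.liminf (fun _ : ℕ ↦ ENNReal.ofReal (barrier d r₁ (x - c))) Filter.atTop := by
          refine Filter.liminf_le_liminf ?_
          have hlim : Filter.Tendsto (fun n : ℕ ↦ 6 * (d / r₁ ^ 2) * α * (1 / ((n : ℝ) + 1)))
              Filter.atTop (nhds 0) := by
            rw [← mul_zero (6 * (d / r₁ ^ 2) * α)]
            exact tendsto_one_div_add_atTop_nhds_zero_nat.const_mul _
          filter_upwards [hlim.eventually_le_const one_pos] with n hn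
          refine lintegral_compensatedBarrier_le hW hα hV hr₁ hV₁ hV₂ (by positivity) ?_ _
          push_cast
          exact hn
      _ = _ := Filter.liminf_const _
  have hb := barrier_sub_div_barrierRate_le (ρ := dist x c) hd hr₁ hα (hV₁ x hx) (hV₂ x hx)
  refine le_trans ?_ (ENNReal.ofReal_le_ofReal hb)
  rw [ENNReal.ofReal_div_of_pos hκ0, ENNReal.le_div_iff_mul_le (.inl (by simpa using hκ0))
    (.inl ENNReal.ofReal_ne_top), mul_comm]
  have hba : Real.exp (-(d / r₁ ^ 2) * r₁ ^ 2) - Real.exp (-(d / r₁ ^ 2) * dist x c ^ 2) =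
      barrier d r₁ (x - c) - a := by
    rw [ha, barrier, ← dist_eq_norm]
    ring
  rw [hba, ENNReal.ofReal_sub _ ha0]
  exact ENNReal.le_sub_of_add_le_right ENNReal.ofReal_ne_top hmain

lemma expectedExitTime_eq_zero (hW : IsWienerMeasure α x W) (hα : 0 < α) (hx : x ∉ V) :
    expectedExitTime W V = 0 := by
  rw [expectedExitTime, ← lintegral_zero (μ := W)]
  refine lintegral_congr_ae ?_
  filter_upwards [hW.ae_eval_zero hα] with X hX
  simpa using exitTime_le (X := X) (t := 0) (by rwa [hX])

end compensatedBarrier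

/-! ### Exterior balls, neighbourhoods and scaling. -/

lemma inv_le_of_mem_Icc {ν α : ℝ} (hν : 1 < ν) (hα : α ∈ Icc (1 / (2 * ν)) (2 * ν)) :
    0 < α ∧ α⁻¹ ≤ 2 * ν := by
  have h0 : 0 < 1 / (2 * ν) := by positivity
  refine ⟨h0.trans_le hα.1, ?_⟩
  rw [inv_le_comm₀ (h0.trans_le hα.1) (by positivity), ← one_div]
  exact hα.1

/-- The constant in the exit time estimates for a domain of diameter `D` satisfying the exterior
ball condition with radius `r`. -/
noncomputable def exteriorBallConst (d : ℕ) (ν r D : ℝ) : ℝ :=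
  32 * ν * (2 * r + D) * Real.exp ((d / (r / 2) ^ 2) * (2 * r + D) ^ 2)

lemma exteriorBallConst_nonneg {d : ℕ} {ν r D : ℝ} (hν : 1 < ν) (hr : 0 < r) (hD : 0 ≤ D) :
    0 ≤ exteriorBallConst d ν r D := by
  unfold exteriorBallConst
  positivity

lemma exteriorBallConst_mul {d : ℕ} {ν r D c : ℝ} (hc : c ≠ 0) :
    exteriorBallConst d ν (c * r) (c * D) = c * exteriorBallConst d ν r D := by
  unfold exteriorBallConst
  have : (d / (c * r / 2) ^ 2) * (2 * (c * r) + c * D) ^ 2 =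
      (d / (r / 2) ^ 2) * (2 * r + D) ^ 2 := by
    have h1 : (c * r / 2) ^ 2 = c ^ 2 * (r / 2) ^ 2 := by ring
    have h2 : (2 * (c * r) + c * D) ^ 2 = c ^ 2 * (2 * r + D) ^ 2 := by ring
    rw [h1, h2, div_mul_eq_mul_div, div_mul_eq_mul_div, mul_left_comm,
      mul_div_mul_left _ _ (pow_ne_zero 2 hc)]
  rw [this]
  ring

section

variable {d : ℕ} {ν α r δ : ℝ} {V S : Set (EuclideanSpace ℝ (Fin d))}
  {x y : EuclideanSpace ℝ (Fin d)}

lemma expectedExitTime_le_of_forall_dist {D : ℝ} {W : Measure (PathSpace d)}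
    (hd : 0 < d) (hν : 1 < ν) (hα : α ∈ Icc (1 / (2 * ν)) (2 * ν)) (hW : IsWienerMeasure α x W)
    (hS : MeasurableSet S) (hδ : 0 < δ) (hδr : δ < r / 2) (hD : 0 ≤ D)
    (hS₁ : ∀ z ∈ S, r - δ ≤ dist z y) (hS₂ : ∀ z ∈ S, dist z y ≤ 2 * r + D)
    (hx : dist x y ≤ r + 3 * δ) :
    expectedExitTime W S ≤ ENNReal.ofReal (exteriorBallConst d ν r D * δ) := by
  obtain ⟨hα0, hαν⟩ := inv_le_of_mem_Icc hν hα
  have hr : 0 < r := by linarith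
  by_cases hxS : x ∈ S
  · refine (expectedExitTime_le_of_subset_annulus hd hW hα0 hS (by linarith) hS₁ hS₂ hxS).trans
      (ENNReal.ofReal_le_ofReal ?_)
    -- This 4, with 4α⁻¹ ≤ 8ν, gives the 32ν in `exteriorBallConst`.
    have h1 : dist x y - (r - δ) ≤ 4 * δ := by linarith
    have h2 : r / 2 ≤ r - δ := by linarith
    have h3 : 0 ≤ dist x y - (r - δ) := sub_nonneg.2 (hS₁ x hxS)
    calc 4 * α⁻¹ * (2 * r + D) * Real.exp ((d / (r - δ) ^ 2) * (2 * r + D) ^ 2) *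
          (dist x y - (r - δ))
        ≤ 4 * (2 * ν) * (2 * r + D) * Real.exp ((d / (r / 2) ^ 2) * (2 * r + D) ^ 2) *
          (4 * δ) := by gcongr
      _ = exteriorBallConst d ν r D * δ := by rw [exteriorBallConst]; ring
  · rw [expectedExitTime_eq_zero hW hα0 hxS]
    exact zero_le

lemma exists_mem_frontier_dist_le (hV : Bornology.IsBounded V) (hδ : 0 ≤ δ)
    (hx : x ∈ cthickening δ (frontier V)) : ∃ z ∈ frontier V, dist x z ≤ δ := by
  have hc : IsCompact (frontier V) :=
    isCompact_of_isClosed_isBounded isClosed_frontier (hV.closure.subset frontier_subset_closure)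
  rw [hc.cthickening_eq_biUnion_closedBall hδ] at hx
  simpa using hx

lemma exists_mem_frontier_dist_eq_of_mem_frontier_thickening (hδ : 0 < δ)
    (hx : x ∈ frontier (thickening δ V)) : ∃ z ∈ frontier V, dist x z = δ := by
  have hx' : infEDist x V = ENNReal.ofReal δ := frontier_thickening_subset V hx
  have hxV : infDist x V = δ := by
    rw [infDist, hx', ENNReal.toReal_ofReal hδ.le]
  have hne : V.Nonempty := by
    by_contra h
    rw [not_nonempty_iff_eq_empty] at h
    rw [h, infDist_empty] at hxV
    exact hδ.ne hxV
  have hxc : x ∈ (closure V)ᶜ := by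
    intro h
    rw [mem_closure_iff_infDist_zero hne, hxV] at h
    exact hδ.ne' h
  have hcu : (closure V)ᶜ ≠ univ := by
    rw [Ne, compl_univ_iff]
    exact hne.closure.ne_empty
  -- The distance from x to V is attained on the frontier of the complement of `closure V`, which is
  -- part of `frontier V`.
  obtain ⟨z, hz, hxz⟩ := exists_mem_frontier_infDist_compl_eq_dist hxc hcu
  rw [compl_compl, infDist_closure, hxV] at hxz
  rw [frontier_compl] at hz
  exact ⟨z, frontier_closure_subset hz, hxz.symm⟩

/-- The exterior ball meets `closure V` only at z, and z is not in the open set V; hence V stays at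
distance at least r from the centre. -/
lemma ExteriorBallCondition.exists_dist (hE : ExteriorBallCondition V r) (hV : IsOpen V)
    (hb : Bornology.IsBounded V) {z : EuclideanSpace ℝ (Fin d)}
    (hz : z ∈ frontier V) :
    ∃ y, dist z y ≤ r ∧ (∀ v ∈ V, r ≤ dist v y) ∧ ∀ v ∈ V, dist v y ≤ r + diam V := by
  obtain ⟨y, hy⟩ := hE z hz
  have hzy : z ∈ closedBall y r := (hy.symm.subset rfl).1
  refine ⟨y, hzy, fun v hv ↦ ?_, fun v hv ↦ ?_⟩
  · by_contra! h
    have hvz : v ∈ ({z} : Set _) := hy.subset ⟨h.le, subset_closure hv⟩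
    rw [mem_singleton_iff] at hvz
    rw [hV.frontier_eq] at hz
    exact hz.2 (hvz ▸ hv)
  · have h1 : dist v z ≤ diam V := by
      rw [← diam_closure]
      exact dist_le_diam_of_mem hb.closure (subset_closure hv) (frontier_subset_closure hz)
    have h2 : dist z y ≤ r := hzy
    linarith [dist_triangle v z y]

variable {W : EuclideanSpace ℝ (Fin d) → Measure (PathSpace d)}

lemma iSup_expectedExitTime_le (hd : 0 < d) (hν : 1 < ν) (hα : α ∈ Icc (1 / (2 * ν)) (2 * ν))
    (hW : ∀ x, IsWienerMeasure α x (W x)) (hV : IsOpen V) (hb : Bornology.IsBounded V)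
    (hE : ExteriorBallCondition V r) (hδ : 0 < δ) (hδr : δ < r / 2) :
    ⨆ x ∈ cthickening δ (frontier V), expectedExitTime (W x) V ≤
      ENNReal.ofReal (exteriorBallConst d ν r (diam V) * δ) := by
  refine iSup₂_le fun x hx ↦ ?_
  obtain ⟨z, hz, hxz⟩ := exists_mem_frontier_dist_le hb hδ.le hx
  obtain ⟨y, hzy, hy₁, hy₂⟩ := hE.exists_dist hV hb hz
  refine expectedExitTime_le_of_forall_dist (y := y) hd hν hα (hW x) hV.measurableSet hδ hδr
    diam_nonneg (fun v hv ↦ ?_) (fun v hv ↦ ?_) ?_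
  · linarith [hy₁ v hv]
  · linarith [hy₂ v hv]
  · linarith [dist_triangle x z y]

lemma iSup_expectedExitTime_thickening_le (hd : 0 < d) (hν : 1 < ν)
    (hα : α ∈ Icc (1 / (2 * ν)) (2 * ν))
    (hW : ∀ x, IsWienerMeasure α x (W x)) (hV : IsOpen V) (hb : Bornology.IsBounded V)
    (hE : ExteriorBallCondition V r) (hδ : 0 < δ) (hδr : δ < r / 2) :
    ⨆ x ∈ cthickening (2 * δ) (frontier (thickening δ V)),
      expectedExitTime (W x) (thickening δ V) ≤
      ENNReal.ofReal (exteriorBallConst d ν r (diam V) * δ) := by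
  refine iSup₂_le fun x hx ↦ ?_
  obtain ⟨x', hx', hxx'⟩ := exists_mem_frontier_dist_le hb.thickening (by positivity) hx
  obtain ⟨z, hz, hxz⟩ := exists_mem_frontier_dist_eq_of_mem_frontier_thickening hδ hx'
  obtain ⟨y, hzy, hy₁, hy₂⟩ := hE.exists_dist hV hb hz
  refine expectedExitTime_le_of_forall_dist (y := y) hd hν hα (hW x) isOpen_thickening.measurableSet
    hδ hδr diam_nonneg (fun w hw ↦ ?_) (fun w hw ↦ ?_) ?_
  · obtain ⟨v, hv, hwv⟩ := mem_thickening_iff.1 hw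
    linarith [hy₁ v hv, dist_triangle_left v y w]
  · obtain ⟨v, hv, hwv⟩ := mem_thickening_iff.1 hw
    linarith [hy₂ v hv, dist_triangle w v y]
  -- The budget r + 3δ is 2δ to the frontier of the neighbourhood, δ on to `frontier V`, and r to
  -- the centre.
  · linarith [dist_triangle x x' y, dist_triangle x' z y]

lemma ExteriorBallCondition.smul {c : ℝ} (hE : ExteriorBallCondition V r) (hc : 0 < c) :
    ExteriorBallCondition (c • V) (c * r) := by
  intro x hx
  have hf : frontier (c • V) = c • frontier V :=
    ((Homeomorph.smulOfNeZero c hc.ne').image_frontier V).symm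
  rw [hf] at hx
  obtain ⟨z, hz, rfl⟩ := hx
  obtain ⟨y, hy⟩ := hE z hz
  refine ⟨c • y, ?_⟩
  have hcb : c • closedBall y r = closedBall (c • y) (c * r) := by
    rw [smul_closedBall' hc.ne', Real.norm_of_nonneg hc.le]
  have hcl : closure (c • V) = c • closure V :=
    ((Homeomorph.smulOfNeZero c hc.ne').image_closure V).symm
  rw [hcl, ← hcb, ← smul_set_inter₀ hc.ne', hy, smul_set_singleton]

end

/-! ### Assembly of the estimates. -/

theorem mainTheorem7 (d : ℕ) (hd : 3 ≤ d) (ν : ℝ) (hν : 1 < ν) :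
    -- the annulus estimate
    (∀ r₁ r₂ : ℝ, 0 < r₁ → r₁ < r₂ →
      ∃ C : ℝ, 0 < C ∧
        ∀ α ∈ Icc (1 / (2 * ν)) (2 * ν),
        ∀ W : EuclideanSpace ℝ (Fin d) → Measure (PathSpace d),
          (∀ x, IsWienerMeasure α x (W x)) →
        ∀ x ∈ closure (annulus d r₁ r₂),
          expectedExitTime (W x) (annulus d r₁ r₂) ≤
            ENNReal.ofReal (C * infDist x (sphere 0 r₁))) ∧
    ∀ (U : Set (EuclideanSpace ℝ (Fin d))) (r₀ : ℝ),
      IsOpen U → Bornology.IsBounded U → 0 < r₀ → ExteriorBallCondition U r₀ →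
      -- the estimates for `U` and for its inflation `U_δ`
      (∃ C : ℝ, 0 < C ∧
        ∀ α ∈ Icc (1 / (2 * ν)) (2 * ν),
        ∀ W : EuclideanSpace ℝ (Fin d) → Measure (PathSpace d),
          (∀ x, IsWienerMeasure α x (W x)) →
        ∀ δ : ℝ, 0 < δ → δ < r₀ / 2 →
          (⨆ x ∈ cthickening δ (frontier U), expectedExitTime (W x) U) ≤
              ENNReal.ofReal (C * δ) ∧
          (⨆ x ∈ cthickening (2 * δ) (frontier (thickening δ U)),
              expectedExitTime (W x) (thickening δ U)) <
            ENNReal.ofReal (C * δ)) ∧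
      -- the estimates for `U / ε` and for its `δ`-neighbourhood
      (∃ C : ℝ, 0 < C ∧
        ∀ α ∈ Icc (1 / (2 * ν)) (2 * ν),
        ∀ W : EuclideanSpace ℝ (Fin d) → Measure (PathSpace d),
          (∀ x, IsWienerMeasure α x (W x)) →
        ∀ ε : ℝ, 0 < ε → ∀ δ : ℝ, 0 < δ → δ < r₀ / (2 * ε) →
          (⨆ x ∈ cthickening δ (frontier (ε⁻¹ • U)), expectedExitTime (W x) (ε⁻¹ • U)) ≤
              ENNReal.ofReal (C * ε⁻¹ * δ) ∧
          (⨆ x ∈ cthickening (2 * δ) (frontier (thickening δ (ε⁻¹ • U))),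
              expectedExitTime (W x) (thickening δ (ε⁻¹ • U))) <
            ENNReal.ofReal (C * ε⁻¹ * δ)) := by
  have hd0 : 0 < d := by omega
  refine ⟨fun r₁ r₂ hr₁ hr ↦ ?_, fun U r₀ hU hb hr₀ hE ↦ ?_⟩
  · have hr₂ : 0 < r₂ := hr₁.trans hr
    refine ⟨4 * (2 * ν) * r₂ * Real.exp ((d / r₁ ^ 2) * r₂ ^ 2), by positivity,
      fun α hα W hW x _ ↦ ?_⟩
    obtain ⟨hα0, hαν⟩ := inv_le_of_mem_Icc hν hα
    by_cases hx : x ∈ annulus d r₁ r₂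
    · have hm : MeasurableSet (annulus d r₁ r₂) :=
        isOpen_ball.measurableSet.diff isClosed_closedBall.measurableSet
      have hA₁ : ∀ z ∈ annulus d r₁ r₂, r₁ ≤ dist z 0 := fun z hz ↦
        (not_le.1 fun h ↦ hz.2 (mem_closedBall.2 h)).le
      have hA₂ : ∀ z ∈ annulus d r₁ r₂, dist z 0 ≤ r₂ := fun z hz ↦ (mem_ball.1 hz.1).le
      refine (expectedExitTime_le_of_subset_annulus hd0 (hW x) hα0 hm hr₁ hA₁ hA₂ hx).trans
        (ENNReal.ofReal_le_ofReal ?_)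
      -- Positive dimension makes the sphere nonempty; `infDist` to an empty set would be 0.
      have : Nonempty (Fin d) := ⟨⟨0, hd0⟩⟩
      have hdist : dist x 0 - r₁ ≤ infDist x (sphere 0 r₁) := by
        refine (le_infDist (NormedSpace.sphere_nonempty.2 hr₁.le)).2 fun z hz ↦ ?_
        linarith [dist_triangle x z 0, mem_sphere.1 hz]
      have := hA₁ x hx
      gcongr
    · rw [expectedExitTime_eq_zero (hW x) hα0 hx]
      exact zero_le
  · set K := exteriorBallConst d ν r₀ (diam U) with hK
    have hK0 : 0 ≤ K := exteriorBallConst_nonneg hν hr₀ diam_nonneg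
    -- Taking `K + 1` instead of `K` makes the constant positive and the second bound strict.
    refine ⟨⟨K + 1, by positivity, fun α hα W hW δ hδ hδr ↦ ⟨?_, ?_⟩⟩,
      ⟨K + 1, by positivity, fun α hα W hW ε hε δ hδ hδr ↦ ?_⟩⟩
    · refine (iSup_expectedExitTime_le hd0 hν hα hW hU hb hE hδ hδr).trans
        (ENNReal.ofReal_le_ofReal ?_)
      gcongr
      linarith
    · refine (iSup_expectedExitTime_thickening_le hd0 hν hα hW hU hb hE hδ hδr).trans_lt
        ((ENNReal.ofReal_lt_ofReal_iff (by positivity)).2 ?_)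
      gcongr
      linarith
    · have hε' : 0 < ε⁻¹ := inv_pos.2 hε
      have hδr' : δ < ε⁻¹ * r₀ / 2 := by
        refine hδr.trans_eq ?_
        field_simp
      have hKε : exteriorBallConst d ν (ε⁻¹ * r₀) (diam (ε⁻¹ • U)) = ε⁻¹ * K := by
        rw [diam_smul₀, Real.norm_of_nonneg hε'.le, exteriorBallConst_mul hε'.ne']
      have hlt : ε⁻¹ * K * δ < (K + 1) * ε⁻¹ * δ := by
        rw [mul_comm ε⁻¹ K]
        gcongr
        linarith
      have hUε : IsOpen (ε⁻¹ • U) := hU.smul₀ hε'.ne'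
      have hbε : Bornology.IsBounded (ε⁻¹ • U) := hb.smul₀ ε⁻¹
      refine ⟨?_, ?_⟩
      · refine (iSup_expectedExitTime_le hd0 hν hα hW hUε hbε (hE.smul hε') hδ hδr').trans
          (ENNReal.ofReal_le_ofReal ?_)
        rw [hKε]
        exact hlt.le
      · refine (iSup_expectedExitTime_thickening_le hd0 hν hα hW hUε hbε (hE.smul hε') hδ
          hδr').trans_lt ((ENNReal.ofReal_lt_ofReal_iff (by positivity)).2 ?_)
        rw [hKε]
        exact hlt
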